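/- Let $K$ be a field, and let $\mathbf{ch}$ be the category of compact chain complexes, i.e. non-negatively graded chain complexes of $K$-vector spaces of finite total dimension. Weak equivalences in $\mathbf{ch}$ are the quasi-isomorphisms, fibrations are the morphisms that are epimorphisms in all degrees $n\ge 1$, and cofibrations are the morphisms that are monomorphisms in all degrees. A functor $X\colon[0,\infty)\to\mathbf{ch}$, $t\mapsto X^t$, is tame if there is a sequence $\tau_0<\dots<\tau_k$ in $[0,\infty)$ that discretises it: for $s\le t$, the transition $X^s\to X^t$ is an isomorphism unless $s<\tau_a\le t$ for some $a$. Let $\mathrm{tame}([0,\infty),\mathbf{ch})$ be the category of tame functors and natural transformations. In it, weak equivalences and fibrations are defined pointwise. A morphism $g\colon X\to Y$ is a cofibration if, for a sequence $0=\tau_0<\dots<\tau_k$ that discretises both $X$ and $Y$, the morphism $g^0\colon X^0\to Y^0$ and the induced morphisms $Y^{\tau_{a-1}}\sqcup_{X^{\tau_{a-1}}}X^{\tau_a}\to Y^{\tau_a}$ ($1\le a\le k$) are cofibrations in $\mathbf{ch}$. An object $X$ is cofibrant if $0\to X$ is a cofibration, and fibrant if $X\to 0$ is a fibration. An object $X$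 is minimal if it is cofibrant, fibrant, and every weak equivalence $X\to X$ is an isomorphism. A morphism $c\colon X\to Y$ is a minimal cover if $X$ is cofibrant, $c$ is a fibration and a weak equivalence, and every $\phi\colon X\to X$ with $c\phi=c$ is an isomorphism. For $n\in\mathbb N$, $s\in[0,\infty)$ and $e\in[s,\infty]$, the interval sphere $S^n[s,e)$ is the tame functor whose value at $t$ is $0$ if $t<s$, the complex $S^n$ ($K$ in degree $n$, zero elsewhere) if $s\le t<e$, and the complex $D^{n+1}$ ($K$ in degrees $n$ and $n+1$ with differential the identity, zero elsewhere) if $e\le t$; its transitions are the inclusions. Every cofibrant object $X$ of $\mathrm{tame}([0,\infty),\mathbf{ch})$ is isomorphic to a finite direct sum $\bigoplus_{n}\bigoplus_{s\le e}S^n[s,e)^{\beta_nX(s,e)}$ with uniquely determined multiplicities $\beta_nX(s,e)\in\mathbb N$, the Betti diagrams of $X$. Proposition. 1. An object $X$ of $\mathrm{tame}([0,\infty),\mathbf{ch})$ is minimal if and only if it is cofibrant and $\beta_nX(s,s)=0$ for all $n\in\mathbb N$ and all $s\in[0,\infty)$. 2. A morphism $c\colon X\to Y$ in $\mathrm{tame}([0,\infty),\mathbf{ch})$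 is a minimal cover if and only if $X$ is cofibrant, $c$ is a weak equivalence and a fibration, and no direct summand of $X$ of the form $S^n[s,s)$, for some $n$ and $s$, is mapped to $0$ by $c$. -/

import Mathlib

open CategoryTheory Limits HomotopicalAlgebra
open scoped NNReal ENNReal ZeroObject

universe u

namespace TameCh

/-! ### Minimality in a category with weak equivalences, fibrations and cofibrations -/

section Minimality

variable {M : Type*} [Category M] [CategoryWithWeakEquivalences M]
  [CategoryWithFibrations M] [CategoryWithCofibrations M]

/-- An object is minimal if it is cofibrant, fibrant, and all of its self weak equivalences are
isomorphisms. -/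
structure IsMinimal [HasInitial M] [HasTerminal M] (X : M) : Prop where
  isCofibrant : IsCofibrant X
  isFibrant : IsFibrant X
  isIso : ∀ φ : X ⟶ X, WeakEquivalence φ → IsIso φ

/-- The factorisation `α ≫ β` is minimal: `α` is a cofibration, `β` is a fibration and a weak
equivalence, and every endomorphism of the middle object that is compatible with `α` and `β` is an
isomorphism. -/
structure IsMinimalFactorisation {X A Y : M} (α : X ⟶ A) (β : A ⟶ Y) : Prop where
  cofibration : Cofibration α
  fibration : Fibration β
  weakEquivalence : WeakEquivalence β
  isIso : ∀ φ : A ⟶ A, α ≫ φ = α → φ ≫ β = β → IsIso φ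

/-- A minimal cover of `Y` is a minimal factorisation `∅ ⟶ X ⟶ Y` of `∅ ⟶ Y`. -/
def IsMinimalCover [HasInitial M] {X Y : M} (c : X ⟶ Y) : Prop :=
  IsMinimalFactorisation (initial.to X) c

end Minimality

/-! ### Tame `[0, ∞)`-parametrised objects -/

section Tame

variable {M : Type*} [Category M]

/-- The sequence `τ` discretises the parametrised object `X`: the transition `X^s ⟶ X^t` may fail
to be an isomorphism only if `s < τ a ≤ t` for some `a`. -/
def Discretises {k : ℕ} (τ : Fin (k + 1) → ℝ≥0) (X : ℝ≥0 ⥤ M) : Prop :=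
  ∀ ⦃s t : ℝ≥0⦄ (h : s ≤ t), (¬ ∃ a, s < τ a ∧ τ a ≤ t) → IsIso (X.map (homOfLE h))

variable (M) in
/-- A functor `[0, ∞) ⥤ M` is tame if some sequence `τ 0 < ⋯ < τ k` discretises it. -/
def IsTame : ObjectProperty (ℝ≥0 ⥤ M) := fun X =>
  ∃ (k : ℕ) (τ : Fin (k + 1) → ℝ≥0), StrictMono τ ∧ Discretises τ X

variable (M) in
/-- The category of tame `[0, ∞)`-parametrised objects of `M` and natural transformations. -/
abbrev Tame := (IsTame M).FullSubcategory

/-- For `g : X ⟶ Y` and `s ≤ t`, the mediating morphism from the pushout of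
`Y^s ⟵ X^s ⟶ X^t` to `Y^t`. -/
noncomputable def mediating [HasPushouts M] {X Y : ℝ≥0 ⥤ M} (g : X ⟶ Y) {s t : ℝ≥0}
    (h : s ≤ t) : pushout (g.app s) (X.map (homOfLE h)) ⟶ Y.obj t :=
  pushout.desc (Y.map (homOfLE h)) (g.app t) (g.naturality (homOfLE h)).symm

/-- Weak equivalences of tame objects are the pointwise ones. -/
instance [CategoryWithWeakEquivalences M] : CategoryWithWeakEquivalences (Tame M) where
  weakEquivalences _ _ g := ∀ t : ℝ≥0, WeakEquivalence (g.hom.app t)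

/-- Fibrations of tame objects are the pointwise ones. -/
instance [CategoryWithFibrations M] : CategoryWithFibrations (Tame M) where
  fibrations _ _ g := ∀ t : ℝ≥0, Fibration (g.hom.app t)

/-- A morphism `g : X ⟶ Y` of tame objects is a cofibration if, along a sequence
`0 = τ 0 < ⋯ < τ k` that discretises both `X` and `Y`, the morphism `g^0` and all the mediating
morphisms from the pushout of `Y^(τ a) ⟵ X^(τ a) ⟶ X^(τ (a + 1))` to `Y^(τ (a + 1))` are
cofibrations. -/
instance [CategoryWithCofibrations M] [HasPushouts M] : CategoryWithCofibrations (Tame M) where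
  cofibrations X Y g :=
    ∃ (k : ℕ) (τ : Fin (k + 1) → ℝ≥0) (hτ : StrictMono τ),
      τ 0 = 0 ∧ Discretises τ X.obj ∧ Discretises τ Y.obj ∧
      Cofibration (g.hom.app 0) ∧
      ∀ a : Fin k, Cofibration (mediating g.hom (hτ (Fin.castSucc_lt_succ (i := a))).le)

instance [HasZeroObject M] [HasZeroMorphisms M] : (IsTame M).ContainsZero where
  exists_zero := by
    refine ⟨(Functor.const _).obj 0, ?_, 0, fun _ => 0,
      fun a b h => absurd h (by omega), ?_⟩
    · exact Functor.isZero _ (fun _ => isZero_zero M)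
    · intro s t h _
      dsimp
      infer_instance

theorem isTame_of_finset (X : ℝ≥0 ⥤ M) (F : Finset ℝ≥0)
    (hF : ∀ ⦃s t : ℝ≥0⦄ (h : s ≤ t), (¬ ∃ a ∈ F, s < a ∧ a ≤ t) → IsIso (X.map (homOfLE h))) :
    IsTame M X := by
  have hc : (insert 0 F).card = ((insert 0 F).card - 1) + 1 := by
    have : 0 < (insert 0 F).card := Finset.card_pos.2 ⟨0, by simp⟩
    omega
  refine ⟨(insert 0 F).card - 1, (insert 0 F).orderEmbOfFin hc, OrderEmbedding.strictMono _, ?_⟩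
  intro s t h hst
  refine hF h ?_
  rintro ⟨a, ha, h1⟩
  have : a ∈ Set.range ((insert 0 F).orderEmbOfFin hc) := by
    rw [Finset.range_orderEmbOfFin]
    simp [ha]
  obtain ⟨i, rfl⟩ := this
  exact hst ⟨i, h1⟩

end Tame

/-! ### Compact chain complexes of vector spaces -/

section Ch

variable (K : Type u) [Field K]

/-- Non-negatively graded chain complexes of `K`-vector spaces. -/
abbrev Ch := ChainComplex (ModuleCat.{u} K) ℕ

/-- Weak equivalences are the morphisms that induce isomorphisms on homology. -/
noncomputable instance : CategoryWithWeakEquivalences (Ch K) where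
  weakEquivalences _ _ g := QuasiIso g

/-- Fibrations are the morphisms that are epimorphisms in all degrees `n ≥ 1`. -/
instance : CategoryWithFibrations (Ch K) where
  fibrations _ _ g := ∀ n : ℕ, 1 ≤ n → Epi (g.f n)

/-- Cofibrations are the morphisms that are monomorphisms in all degrees. -/
instance : CategoryWithCofibrations (Ch K) where
  cofibrations _ _ g := ∀ n : ℕ, Mono (g.f n)

/-- A chain complex is compact if its total dimension is finite, that is, if it is finite
dimensional in every degree and trivial in all large degrees. -/
def IsCompactComplex : ObjectProperty (Ch K) := fun X =>
  (∀ n, Module.Finite K (X.X n)) ∧ ∃ N, ∀ n, N ≤ n → IsZero (X.X n)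

/-- The full subcategory of compact chain complexes. Its weak equivalences, fibrations and
cofibrations are those of chain complexes (for the weak equivalences this is Mathlib's instance for
a full subcategory). -/
abbrev CompactCh := (IsCompactComplex K).FullSubcategory

/-- Fibrations of compact complexes are those of chain complexes. -/
instance : CategoryWithFibrations (CompactCh K) where
  fibrations _ _ g := Fibration g.hom

/-- Cofibrations of compact complexes are those of chain complexes. -/
instance : CategoryWithCofibrations (CompactCh K) where
  cofibrations _ _ g := Cofibration g.hom

instance : (IsCompactComplex K).ContainsZero where
  exists_zero := by
    refine ⟨0, isZero_zero _, fun n => ?_, 0, fun n _ => ?_⟩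
    · have h : IsZero ((0 : Ch K).X n) :=
        (HomologicalComplex.eval (ModuleCat.{u} K) (ComplexShape.down ℕ) n).map_isZero
          (isZero_zero _)
      have := ModuleCat.subsingleton_of_isZero h
      infer_instance
    · exact (HomologicalComplex.eval (ModuleCat.{u} K) (ComplexShape.down ℕ) n).map_isZero
          (isZero_zero _)

instance : (IsCompactComplex K).IsClosedUnderColimitsOfShape WalkingSpan where
  colimitsOfShape_le := by
    rintro Y ⟨⟨D, ι, hY⟩, hD⟩
    have hc : ∀ n, IsColimit
        ((HomologicalComplex.eval (ModuleCat.{u} K) (ComplexShape.down ℕ) n).mapCocone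
          (Cocone.mk Y ι)) :=
      fun n => isColimitOfPreserves _ hY
    refine ⟨fun n => ?_, ?_⟩
    · have hfin : ∀ j, Module.Finite K ((D.obj j).X n) := fun j => (hD j).1 n
      let S : Submodule K (Y.X n) := ⨆ j : WalkingSpan, LinearMap.range ((ι.app j).f n).hom
      have hS : S.FG := Submodule.fg_iSup _ (fun j => by
        rw [LinearMap.range_eq_map]
        exact Module.Finite.fg_top.map _)
      have h0 : ModuleCat.ofHom S.mkQ = 0 := by
        refine (hc n).hom_ext fun j => ?_
        ext x
        exact (Submodule.Quotient.mk_eq_zero S).2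
          (Submodule.mem_iSup_of_mem j (LinearMap.mem_range_self _ x))
      have hT : S = ⊤ := by
        rw [← Submodule.ker_mkQ S, LinearMap.ker_eq_top]
        exact congrArg ModuleCat.Hom.hom h0
      exact ⟨hT ▸ hS⟩
    · choose N hN using fun j => (hD j).2
      refine ⟨Finset.univ.sup N, fun n hn => ?_⟩
      rw [IsZero.iff_id_eq_zero]
      refine (hc n).hom_ext fun j => ?_
      exact (hN j n ((Finset.le_sup (Finset.mem_univ j)).trans hn)).eq_of_src _ _

instance : HasPushouts (CompactCh K) :=
  inferInstanceAs (HasColimitsOfShape WalkingSpan (CompactCh K))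

end Ch

/-! ### Interval spheres -/

/-- The set of pairs `(s, e)` in `[0, ∞) × [0, ∞]` with `s ≤ e`. -/
abbrev Omega := {p : ℝ≥0 × ℝ≥0∞ // (p.1 : ℝ≥0∞) ≤ p.2}

/-- The diagonal element `(s, s)`. -/
def Omega.diag (s : ℝ≥0) : Omega := ⟨(s, (s : ℝ≥0∞)), le_rfl⟩

section Sphere

variable (K : Type u) [Field K]

/-- The subspace of `K` that is `K` if `p` holds and `0` otherwise. -/
def cell (p : Prop) : Submodule K K where
  carrier := {x | p ∨ x = 0}
  zero_mem' := Or.inr rfl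
  add_mem' := by
    rintro a b (ha | ha) (hb | hb)
    exacts [Or.inl ha, Or.inl ha, Or.inl hb, Or.inr (by simp [ha, hb])]
  smul_mem' := by
    rintro c x (hx | hx)
    exacts [Or.inl hx, Or.inr (by simp [hx])]

/-- The interval sphere has a copy of `K` in degree `n` at the parameters `t ≥ s`, and a copy of
`K` in degree `n + 1` at the parameters `t ≥ e`. -/
def present (n : ℕ) (I : Omega) (t : ℝ≥0) (i : ℕ) : Prop :=
  (i = n ∧ I.1.1 ≤ t) ∨ (i = n + 1 ∧ I.1.2 ≤ (t : ℝ≥0∞))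

/-- The value at `t` of the interval sphere `S^n[s, e)`: the zero complex if `t < s`, the sphere
`S^n` if `s ≤ t < e`, and the disk `D^(n + 1)` if `e ≤ t`. The differential from degree `n + 1` to
degree `n` is induced by the identity of `K`, all others vanish. -/
noncomputable def intervalSphereComplex (n : ℕ) (I : Omega) (t : ℝ≥0) : Ch K where
  X i := ModuleCat.of K (cell K (present n I t i))
  d i j := ModuleCat.ofHom
    ((((if i = n + 1 ∧ j = n then (1 : K) else 0) • (LinearMap.id : K →ₗ[K] K)).comp
      (cell K (present n I t i)).subtype).codRestrict (cell K (present n I t j)) (by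
        rintro ⟨x, hx⟩
        by_cases hij : i = n + 1 ∧ j = n
        · rcases hx with hx | hx
          · refine Or.inl (Or.inl ⟨hij.2, ?_⟩)
            rcases hx with hx | hx
            · exact hx.2
            · exact_mod_cast I.2.trans hx.2
          · exact Or.inr (by simp [hx])
        · exact Or.inr (by simp [hij])))
  shape i j hij := by
    have : ¬ (i = n + 1 ∧ j = n) := by
      rintro ⟨rfl, rfl⟩
      exact hij rfl
    ext x
    change (if i = n + 1 ∧ j = n then (1 : K) else 0) * x.1 = 0
    simp [this]
  d_comp_d' i j k _ _ := by
    ext x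
    change (if j = n + 1 ∧ k = n then (1 : K) else 0) *
      ((if i = n + 1 ∧ j = n then (1 : K) else 0) * x.1) = 0
    by_cases h : i = n + 1 ∧ j = n
    · have : ¬ (j = n + 1 ∧ k = n) := by omega
      simp [this]
    · simp [h]

theorem cell_mono {p q : Prop} (h : p → q) : cell K p ≤ cell K q := fun _ hx => hx.imp_left h

theorem present_mono (n : ℕ) (I : Omega) {t t' : ℝ≥0} (h : t ≤ t') (i : ℕ) :
    present n I t i → present n I t' i :=
  Or.imp (And.imp_right fun hs => hs.trans h)
    (And.imp_right fun he => he.trans (by exact_mod_cast h))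

/-- The transition morphisms of the interval sphere, which are the inclusions. -/
noncomputable def intervalSphereMap (n : ℕ) (I : Omega) {t t' : ℝ≥0} (h : t ≤ t') :
    intervalSphereComplex K n I t ⟶ intervalSphereComplex K n I t' where
  f i := ModuleCat.ofHom (Submodule.inclusion (cell_mono K (present_mono n I h i)))
  comm' _ _ _ := rfl

theorem isCompactComplex_intervalSphereComplex (n : ℕ) (I : Omega) (t : ℝ≥0) :
    IsCompactComplex K (intervalSphereComplex K n I t) := by
  refine ⟨fun i => ?_, n + 2, fun i hi => ?_⟩
  · change Module.Finite K (cell K (present n I t i))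
    infer_instance
  · have : Subsingleton (cell K (present n I t i)) := by
      refine ⟨fun a b => Subtype.ext ?_⟩
      have h : ¬ present n I t i := by
        rintro (h | h) <;> omega
      rw [a.2.resolve_left h, b.2.resolve_left h]
    exact ModuleCat.isZero_of_subsingleton (ModuleCat.of K (cell K (present n I t i)))

/-- The interval sphere `S^n[s, e)` as a functor `[0, ∞) ⥤ ch`. -/
noncomputable def intervalSphereFunctor (n : ℕ) (I : Omega) : ℝ≥0 ⥤ CompactCh K where
  obj t := ⟨intervalSphereComplex K n I t, isCompactComplex_intervalSphereComplex K n I t⟩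
  map f := ObjectProperty.homMk (intervalSphereMap K n I (leOfHom f))
  map_id _ := rfl
  map_comp _ _ := rfl

theorem isTame_intervalSphereFunctor (n : ℕ) (I : Omega) :
    IsTame (CompactCh K) (intervalSphereFunctor K n I) := by
  refine isTame_of_finset _ {I.1.1, I.1.2.toNNReal} ?_
  intro s t h hst
  have key : ∀ i, present n I t i → present n I s i := by
    rintro i (⟨hi, hs⟩ | ⟨hi, he⟩)
    · refine Or.inl ⟨hi, ?_⟩
      by_contra hlt
      exact hst ⟨I.1.1, by simp, not_le.1 hlt, hs⟩
    · refine Or.inr ⟨hi, ?_⟩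
      have hfin : I.1.2 ≠ ∞ := ne_top_of_le_ne_top ENNReal.coe_ne_top he
      by_contra hlt
      refine hst ⟨I.1.2.toNNReal, by simp, ?_, ?_⟩
      · rw [← ENNReal.coe_lt_coe, ENNReal.coe_toNNReal hfin]
        exact not_le.1 hlt
      · rw [← ENNReal.coe_le_coe, ENNReal.coe_toNNReal hfin]
        exact he
  let g : intervalSphereComplex K n I t ⟶ intervalSphereComplex K n I s :=
    { f := fun i => ModuleCat.ofHom (Submodule.inclusion (cell_mono K (key i)))
      comm' := fun _ _ _ => rfl }
  exact ⟨⟨ObjectProperty.homMk g, rfl, rfl⟩⟩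

/-- The interval sphere `S^n[s, e)`, for `I = (s, e)`, as an object of `tame([0, ∞), ch)`. -/
noncomputable def intervalSphere (n : ℕ) (I : Omega) : Tame (CompactCh K) :=
  ⟨intervalSphereFunctor K n I, isTame_intervalSphereFunctor K n I⟩

end Sphere

/-! ### Betti diagrams -/

section Betti

variable {K : Type u} [Field K]

/-- `X` is a finite direct sum of interval spheres in which `S^n[s, e)` occurs exactly `β n (s, e)`
times. -/
def IsBettiDiagrams (X : Tame (CompactCh K)) (β : ℕ → Omega → ℕ) : Prop :=
  Finite (Σ p : ℕ × Omega, Fin (β p.1 p.2)) ∧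
  ∃ ι : ∀ j : (Σ p : ℕ × Omega, Fin (β p.1 p.2)), intervalSphere K j.1.1 j.1.2 ⟶ X,
    Nonempty (IsColimit (Cofan.mk X ι))

open Classical in
/-- The Betti diagrams of `X`, that is, the multiplicities of the interval spheres in a
decomposition of `X` as a finite direct sum of interval spheres. Every cofibrant object has such a
decomposition, and the multiplicities do not depend on it. Only the values on cofibrant objects are
meaningful: an object without a decomposition is given the value `0`. -/
noncomputable def betti (X : Tame (CompactCh K)) : ℕ → Omega → ℕ :=
  if h : ∃ β, IsBettiDiagrams X β then h.choose else 0

end Betti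

end TameCh

open TameCh

namespace TameCh

section Retracts

variable {M : Type*} [Category M]

/-! Both equivalences rest on one trade between weak self equivalences and acyclic summands. If
`S^n[s,s)` is a direct summand of `X`, with inclusion `i` and retraction `r`, then `𝟙 X - r ≫ i` is
a weak equivalence, because the summand is acyclic. It kills `i`, so it is not an isomorphism, and
it is compatible with `c` as soon as `i ≫ c = 0`.

Conversely, let `φ` be a weak self equivalence of a cofibrant `X` that is not an isomorphism. The
transitions of `X` are monomorphisms, so `X` embeds in its value at a late parameter and `End X` is
finite dimensional. Hence `φ` is integral over `K`, and its Fitting idempotent splits off a nonzero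
retract `Z` on which some power of `φ` vanishes. That power is invertible on homology, so `Z` is
acyclic; and `φ ≫ c = c` forces `c` to vanish on `Z`. A nonzero object with monomorphic transitions
has an interval sphere as a retract (`exists_sphere_retract`), and acyclicity makes it some
`S^n[s,s)`. This is `exists_sphere_diag_retract`.

For Betti diagrams it remains to see that a sum of spheres with `s < e` has no retract `S^n[s,s)`:
an endomorphism of `S^n[s,s)` that factors through such a sphere kills the generator at `s` in
degree `n` (`sphere_comp_eq_zero`), so the identity is not a sum of such maps. This works for any
decomposition, so uniqueness of multiplicities is never needed. -/

theorem Discretises.of_retract {k : ℕ} {τ : Fin (k + 1) → ℝ≥0} {X Z : ℝ≥0 ⥤ M}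
    (hX : Discretises τ X) (i : Z ⟶ X) (r : X ⟶ Z) (h : i ≫ r = 𝟙 Z) : Discretises τ Z := by
  intro s t hst hn
  have := hX hst hn
  have hr : ∀ t, i.app t ≫ r.app t = 𝟙 _ := fun t => by
    rw [← NatTrans.comp_app, h, NatTrans.id_app]
  refine ⟨⟨i.app t ≫ inv (X.map (homOfLE hst)) ≫ r.app s, ?_, ?_⟩⟩
  · rw [i.naturality_assoc, IsIso.hom_inv_id_assoc, hr]
  · simp only [Category.assoc]
    rw [← r.naturality, IsIso.inv_hom_id_assoc, hr]

end Retracts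

/-! ### Evaluation, homology and splitting of idempotents -/

variable {K : Type u} [Field K]

variable (K) in
/-- Evaluation of a tame object at the parameter `t`, as a chain complex. -/
noncomputable def evalCh (t : ℝ≥0) : Tame (CompactCh K) ⥤ Ch K :=
  (IsTame _).ι ⋙ (evaluation _ _).obj t ⋙ (IsCompactComplex K).ι

instance (t : ℝ≥0) : (evalCh K t).Additive := by unfold evalCh; infer_instance

variable (K) in
/-- Homology in degree `n` at the parameter `t`. -/
noncomputable def homologyAt (t : ℝ≥0) (n : ℕ) : Tame (CompactCh K) ⥤ ModuleCat.{u} K :=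
  evalCh K t ⋙ HomologicalComplex.homologyFunctor _ _ n

instance (t : ℝ≥0) (n : ℕ) : (homologyAt K t n).Additive := by
  unfold homologyAt; infer_instance

/-- The transition morphisms of a tame object, as morphisms of chain complexes. -/
noncomputable def trans (X : Tame (CompactCh K)) {s t : ℝ≥0} (h : s ≤ t) :
    (evalCh K s).obj X ⟶ (evalCh K t).obj X :=
  (IsCompactComplex K).ι.map (X.obj.map (homOfLE h))

theorem trans_refl (X : Tame (CompactCh K)) (s : ℝ≥0) : trans X (le_refl s) = 𝟙 _ :=
  (congrArg (IsCompactComplex K).ι.map (X.obj.map_id s)).trans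
    ((IsCompactComplex K).ι.map_id _)

theorem trans_trans (X : Tame (CompactCh K)) {s t v : ℝ≥0} (h : s ≤ t) (h' : t ≤ v) :
    trans X h ≫ trans X h' = trans X (h.trans h') := by
  unfold trans
  erw [← (IsCompactComplex K).ι.map_comp, ← X.obj.map_comp]
  rfl

theorem trans_naturality {X Y : Tame (CompactCh K)} (g : X ⟶ Y) {s t : ℝ≥0} (h : s ≤ t) :
    trans X h ≫ (evalCh K t).map g = (evalCh K s).map g ≫ trans Y h :=
  congrArg (IsCompactComplex K).ι.map (g.hom.naturality (homOfLE h))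

/-- A morphism of tame objects from its components. -/
noncomputable def mkHom {X Y : Tame (CompactCh K)}
    (f : ∀ t, (evalCh K t).obj X ⟶ (evalCh K t).obj Y)
    (hf : ∀ ⦃s t : ℝ≥0⦄ (h : s ≤ t), trans X h ≫ f t = f s ≫ trans Y h) : X ⟶ Y :=
  ObjectProperty.homMk
    { app := fun t => ObjectProperty.homMk (f t)
      naturality := fun s t h => by
        ext1
        exact hf (leOfHom h) }

theorem hom_ext_evalCh {X Y : Tame (CompactCh K)} {f g : X ⟶ Y}
    (h : ∀ t, (evalCh K t).map f = (evalCh K t).map g) : f = g := by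
  ext t : 3
  exact ObjectProperty.hom_ext _ (h t)

theorem weakEquivalence_iff_homologyAt {X Y : Tame (CompactCh K)} (g : X ⟶ Y) :
    WeakEquivalence g ↔ ∀ t n, IsIso ((homologyAt K t n).map g) := by
  rw [weakEquivalence_iff]
  refine forall_congr' fun t => ?_
  rw [weakEquivalence_iff]
  change QuasiIso (g.hom.app t).hom ↔ _
  rw [quasiIso_iff]
  refine forall_congr' fun n => ?_
  rw [quasiIsoAt_iff_isIso_homologyMap]
  rfl

/-- Idempotents split among all functors to chain complexes; the retract inherits compactness and
tameness from `X`. -/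
instance : IsIdempotentComplete (Tame (CompactCh K)) where
  idempotents_split X p hp := by
    let J : Tame (CompactCh K) ⥤ (ℝ≥0 ⥤ Ch K) :=
      (IsTame _).ι ⋙ (Functor.whiskeringRight _ _ _).obj (IsCompactComplex K).ι
    obtain ⟨Z, i, r, hir, hri⟩ := IsIdempotentComplete.idempotents_split (J.obj X) (J.map p)
      (by rw [← J.map_comp, hp])
    have h1 : ∀ t, i.app t ≫ r.app t = 𝟙 _ := fun t => by
      rw [← NatTrans.comp_app, hir, NatTrans.id_app]
    have h2 : ∀ t n, (i.app t).f n ≫ (r.app t).f n = 𝟙 _ := fun t n => by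
      rw [← HomologicalComplex.comp_f, h1, HomologicalComplex.id_f]
    have hZ : ∀ t, IsCompactComplex K (Z.obj t) := by
      intro t
      have hX : IsCompactComplex K ((J.obj X).obj t) := (X.obj.obj t).property
      refine ⟨fun n => ?_, ?_⟩
      · have := hX.1 n
        refine Module.Finite.of_surjective ((r.app t).f n).hom fun z => ⟨((i.app t).f n).hom z, ?_⟩
        exact congrArg (fun f => f.hom z) (h2 t n)
      · obtain ⟨N, hN⟩ := hX.2
        refine ⟨N, fun n hn => ?_⟩
        rw [IsZero.iff_id_eq_zero, ← h2 t n]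
        exact (hN n hn).eq_zero_of_tgt ((i.app t).f n) ▸ zero_comp
    let Z' : ℝ≥0 ⥤ CompactCh K := (IsCompactComplex K).lift Z hZ
    let i' : Z' ⟶ X.obj :=
      { app := fun t => ObjectProperty.homMk (i.app t)
        naturality := fun s t h => by ext1; exact i.naturality h }
    let r' : X.obj ⟶ Z' :=
      { app := fun t => ObjectProperty.homMk (r.app t)
        naturality := fun s t h => by ext1; exact r.naturality h }
    have h' : i' ≫ r' = 𝟙 _ := by
      ext t : 2
      exact ObjectProperty.hom_ext _ (h1 t)
    refine ⟨⟨Z', ?_⟩, ObjectProperty.homMk i', ObjectProperty.homMk r', ?_, ?_⟩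
    · obtain ⟨k, τ, hτ, hX⟩ := X.property
      exact ⟨k, τ, hτ, hX.of_retract i' r' h'⟩
    · exact ObjectProperty.hom_ext _ h'
    · refine hom_ext_evalCh fun t => ?_
      exact congrArg (fun f => f.app t) hri

/-! ### Cofibrant objects have monomorphic transitions -/

/-- All transition morphisms are degreewise monomorphisms. -/
def HasMonoTransitions (X : Tame (CompactCh K)) : Prop :=
  ∀ ⦃s t : ℝ≥0⦄ (h : s ≤ t), Mono (trans X h)

theorem HasMonoTransitions.of_retract {X Z : Tame (CompactCh K)} (hX : HasMonoTransitions X)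
    (i : Z ⟶ X) (r : X ⟶ Z) (h : i ≫ r = 𝟙 Z) : HasMonoTransitions Z := by
  intro s t hst
  have : ∀ t, Mono ((evalCh K t).map i) := fun t =>
    have : IsSplitMono i := ⟨⟨⟨r, h⟩⟩⟩
    inferInstance
  have := hX hst
  have h3 : Mono (trans Z hst ≫ (evalCh K t).map i) := by
    rw [trans_naturality]
    infer_instance
  exact mono_of_mono _ ((evalCh K t).map i)

theorem Discretises.isIso_trans {X : Tame (CompactCh K)} {k : ℕ} {τ : Fin (k + 1) → ℝ≥0}
    (hX : Discretises τ X.obj) {s t : ℝ≥0} (h : s ≤ t) (hn : ¬ ∃ a, s < τ a ∧ τ a ≤ t) :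
    IsIso (trans X h) := by
  have := hX h hn
  exact Functor.map_isIso (IsCompactComplex K).ι _

theorem isZero_obj {X : Tame (CompactCh K)} (h : IsZero X) (t : ℝ≥0) : IsZero (X.obj.obj t) :=
  ((IsTame (CompactCh K)).ι ⋙ (evaluation _ _).obj t).map_isZero h

/-- Over a zero object the pushout is the value of `X` at `s`, so the mediating morphism is the
transition up to an isomorphism. -/
theorem mono_trans_of_mediating {A X : Tame (CompactCh K)} (hA : IsZero A) (g : A ⟶ X)
    {s t : ℝ≥0} (h : s ≤ t) (hc : Cofibration (mediating g.hom h)) : Mono (trans X h) := by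
  have : IsIso (A.obj.map (homOfLE h)) :=
    (isZero_obj hA s).isIso (isZero_obj hA t) _
  have hm : ∀ n, Mono ((mediating g.hom h).hom.f n) := by
    rw [cofibration_iff] at hc
    have : Cofibration (mediating g.hom h).hom := hc
    rw [cofibration_iff] at this
    exact this
  have hm' : Mono (mediating g.hom h).hom := HomologicalComplex.mono_of_mono_f _ hm
  have e : trans X h = (IsCompactComplex K).ι.map
      (pushout.inl (g.hom.app s) (A.obj.map (homOfLE h))) ≫ (mediating g.hom h).hom := by
    have : X.obj.map (homOfLE h) =
        pushout.inl (g.hom.app s) (A.obj.map (homOfLE h)) ≫ mediating g.hom h := by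
      exact (pushout.inl_desc _ _ _).symm
    unfold trans
    rw [this]
    rfl
  rw [e]
  have : IsIso ((IsCompactComplex K).ι.map
      (pushout.inl (g.hom.app s) (A.obj.map (homOfLE h)))) := Functor.map_isIso _ _
  exact mono_comp' (@IsIso.mono_of_iso _ _ _ _ _ this) hm'

theorem hasMonoTransitions_of_isCofibrant {X : Tame (CompactCh K)} (hX : IsCofibrant X) :
    HasMonoTransitions X := by
  rw [IsCofibrant, cofibration_iff] at hX
  obtain ⟨k, τ, hτ, h0, -, hd, -, hm⟩ := hX
  have step : ∀ (a : ℕ) (ha : a < k + 1) (s : ℝ≥0) (h : s ≤ τ ⟨a, ha⟩), Mono (trans X h) := by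
    intro a
    induction a with
    | zero =>
      intro ha s h
      obtain rfl : s = τ ⟨0, ha⟩ := le_antisymm h (h0.trans_le zero_le)
      rw [trans_refl]
      infer_instance
    | succ a ih =>
      intro ha s h
      have ha' : a < k := by omega
      have hlt : τ ⟨a, by omega⟩ < τ ⟨a + 1, ha⟩ := hτ (by simp)
      have m : Mono (trans X hlt.le) :=
        mono_trans_of_mediating initialIsInitial.isZero (initial.to X) _ (hm ⟨a, ha'⟩)
      rcases le_total s (τ ⟨a, by omega⟩) with hs | hs
      · have := ih (by omega) s hs
        rw [← trans_trans X hs hlt.le]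
        infer_instance
      · rcases h.eq_or_lt with rfl | h'
        · rw [trans_refl]
          infer_instance
        -- No break point lies in `(τ a, s]`, so the monomorphism `m` can be divided by an
        -- invertible transition.
        · have : IsIso (trans X hs) := by
            refine hd.isIso_trans hs ?_
            rintro ⟨b, hb1, hb2⟩
            have hb3 := hτ.lt_iff_lt.1 hb1
            have hb4 := hτ.lt_iff_lt.1 (hb2.trans_lt h')
            simp only [Fin.lt_def] at hb3 hb4
            omega
          rw [← trans_trans X hs h] at m
          have e : trans X h = inv (trans X hs) ≫ trans X hs ≫ trans X h := by simp
          rw [e]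
          infer_instance
  have last : ∀ {s t : ℝ≥0} (h : s ≤ t), τ (Fin.last k) ≤ s → IsIso (trans X h) := by
    intro s t h hs
    refine hd.isIso_trans h ?_
    rintro ⟨b, hb, -⟩
    exact absurd (hτ.lt_iff_lt.1 (hs.trans_lt hb)) (not_lt.2 (Fin.le_last b))
  intro s t h
  rcases le_total t (τ (Fin.last k)) with ht | ht
  · have := step k (by omega) s (h.trans ht)
    rw [← trans_trans X h ht] at this
    exact mono_of_mono _ (trans X ht)
  · rcases le_total s (τ (Fin.last k)) with hs | hs
    · have := step k (by omega) s hs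
      have := last ht le_rfl
      rw [← trans_trans X hs ht]
      infer_instance
    · have := last h hs
      infer_instance

theorem isFibrant (X : Tame (CompactCh K)) : IsFibrant X := by
  rw [IsFibrant, fibration_iff]
  intro t
  rw [fibration_iff]
  change Fibration ((terminal.from X).hom.app t).hom
  rw [fibration_iff]
  intro n _
  have : IsZero (((evalCh K t).obj (⊤_ (Tame (CompactCh K)))).X n) :=
    (HomologicalComplex.eval _ _ n).map_isZero
      ((evalCh K t).map_isZero terminalIsTerminal.isZero)
  exact ⟨fun a b _ => this.eq_of_src a b⟩

/-! ### Fitting idempotents -/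

section Fitting

open Polynomial in
/-- The Fitting idempotent of an integral element: it projects to the part on which the element is
nilpotent. -/
theorem exists_fitting_idempotent {K E : Type*} [Field K] [Ring E] [Algebra K E] {a : E}
    (ha : IsIntegral K a) :
    ∃ e : E, e * e = e ∧ (∃ N : ℕ, a ^ N * e = 0) ∧ (e = 0 → IsUnit a) := by
  obtain ⟨q, hq, hd⟩ := exists_eq_pow_rootMultiplicity_mul_and_not_dvd (minpoly K a)
    (minpoly.ne_zero ha) 0
  set k := rootMultiplicity 0 (minpoly K a)
  rw [map_zero, sub_zero] at hq hd
  -- The minimal polynomial is `X ^ k * q` with `q` prime to `X`. The exponent `k + 1` leaves a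
  -- factor `X` even for `k = 0`: if the idempotent `(v * q)(a)` vanishes, then `(u * X ^ k)(a)` is
  -- an inverse of `a`.
  have hc : IsCoprime (X ^ (k + 1)) q :=
    IsCoprime.pow_left ((Polynomial.prime_X.irreducible.coprime_iff_not_dvd).2 hd)
  obtain ⟨u, v, huv⟩ := hc
  have hm : aeval a (X ^ k * q) = 0 := by rw [← hq, minpoly.aeval]
  refine ⟨aeval a (v * q), ?_, ⟨k, ?_⟩, fun h => ?_⟩
  · rw [← map_mul]
    have : v * q * (v * q) = v * q - (X ^ k * q) * (u * v * X) := by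
      linear_combination (v * q) * huv
    rw [this, map_sub, map_mul _ (X ^ k * q), hm, zero_mul, sub_zero]
  · have : a ^ k = aeval a (X ^ k : K[X]) := by simp
    rw [this, ← map_mul, show X ^ k * (v * q) = (X ^ k * q) * v by ring, map_mul, hm, zero_mul]
  · have h1 : aeval a (u * X ^ (k + 1)) = 1 := by
      rw [← eq_sub_iff_add_eq] at huv
      rw [huv, map_sub, h, sub_zero, map_one]
    refine isUnit_iff_exists.2 ⟨aeval a (u * X ^ k), ?_, ?_⟩
    · rw [show u * X ^ (k + 1) = X * (u * X ^ k) by ring, map_mul, aeval_X] at h1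
      exact h1
    · rw [show u * X ^ (k + 1) = (u * X ^ k) * X by ring, map_mul, aeval_X] at h1
      exact h1

end Fitting

/-! ### Stable values and finiteness of endomorphism rings -/

theorem exists_forall_isIso_trans (X : Tame (CompactCh K)) :
    ∃ T, ∀ ⦃t⦄ (h : T ≤ t), IsIso (trans X h) := by
  obtain ⟨k, τ, hτ, hd⟩ := X.property
  refine ⟨τ (Fin.last k), fun t h => hd.isIso_trans h ?_⟩
  rintro ⟨b, hb, -⟩
  exact absurd (hτ.lt_iff_lt.1 hb) (not_lt.2 (Fin.le_last b))

/-- The comparison of the value at `t` with the value at a parameter `T` after which the tame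
object is constant. -/
noncomputable def toStable (X : Tame (CompactCh K)) {T : ℝ≥0}
    (hT : ∀ ⦃t⦄ (h : T ≤ t), IsIso (trans X h)) (t : ℝ≥0) :
    (evalCh K t).obj X ⟶ (evalCh K T).obj X :=
  have := hT (le_max_right t T)
  trans X (le_max_left t T) ≫ inv (trans X (le_max_right t T))

section ToStable

variable (X : Tame (CompactCh K)) {T : ℝ≥0} (hT : ∀ ⦃t⦄ (h : T ≤ t), IsIso (trans X h))

theorem toStable_trans (t : ℝ≥0) :
    toStable X hT t ≫ trans X (le_max_right t T) = trans X (le_max_left t T) := by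
  simp [toStable]

theorem trans_toStable {s t : ℝ≥0} (h : s ≤ t) : trans X h ≫ toStable X hT t = toStable X hT s := by
  have := hT (le_max_right t T)
  rw [← cancel_mono (trans X (le_max_right t T)), Category.assoc, toStable_trans,
    trans_trans, ← trans_trans X (le_max_right s T) (max_le_max_right T h),
    ← Category.assoc, toStable_trans, trans_trans]

theorem toStable_self : toStable X hT T = 𝟙 _ := by
  have := hT (le_max_right T T)
  rw [← cancel_mono (trans X (le_max_right T T)), toStable_trans, Category.id_comp]

theorem mono_toStable (hX : HasMonoTransitions X) (t : ℝ≥0) : Mono (toStable X hT t) := by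
  have := hX (le_max_left t T)
  have := hT (le_max_right t T)
  have h : Mono (toStable X hT t ≫ trans X (le_max_right t T)) := by
    rwa [toStable_trans]
  exact mono_of_mono _ (trans X (le_max_right t T))

theorem map_toStable (φ : X ⟶ X) (t : ℝ≥0) :
    (evalCh K t).map φ ≫ toStable X hT t = toStable X hT t ≫ (evalCh K T).map φ := by
  have := hT (le_max_right t T)
  rw [← cancel_mono (trans X (le_max_right t T)), Category.assoc, toStable_trans,
    ← trans_naturality, Category.assoc, ← trans_naturality, ← Category.assoc, toStable_trans]

end ToStable

/-- As `X` embeds in its stable value, an endomorphism is determined by its finitely many nonzero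
components there. -/
theorem finite_end {X : Tame (CompactCh K)} (hX : HasMonoTransitions X) :
    Module.Finite K (End X) := by
  obtain ⟨T, hT⟩ := exists_forall_isIso_trans X
  obtain ⟨hf, N, hN⟩ : IsCompactComplex K ((evalCh K T).obj X) := (X.obj.obj T).property
  have : ∀ n : Fin N, Module.Finite K (((evalCh K T).obj X).X n) := fun n => hf n
  let F : (X ⟶ X) →ₗ[K] (∀ n : Fin N,
      ((evalCh K T).obj X).X n →ₗ[K] ((evalCh K T).obj X).X n) :=
    { toFun := fun φ n => (((evalCh K T).map φ).f n).hom
      map_add' := fun _ _ => rfl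
      map_smul' := fun _ _ => rfl }
  refine Module.Finite.of_injective F fun φ ψ h => hom_ext_evalCh fun t => ?_
  have := mono_toStable X hT hX t
  rw [← cancel_mono (toStable X hT t), map_toStable, map_toStable]
  congr 1
  ext n : 1
  by_cases hn : n < N
  · exact ModuleCat.hom_ext (congrFun h ⟨n, hn⟩)
  · exact (hN n (not_lt.1 hn)).eq_of_src _ _

/-! ### Homology of interval spheres -/

/-- In degree `0` the truncated `j - 1` is `0` and `d 0 0` vanishes, so every element counts as a
cycle. -/
theorem exactAt_iff_forall (C : Ch K) (j : ℕ) : C.ExactAt j ↔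
    ∀ x : C.X j, (C.d j (j - 1)).hom x = 0 → ∃ y : C.X (j + 1), (C.d (j + 1) j).hom y = x := by
  rw [HomologicalComplex.exactAt_iff' C (j + 1) j (j - 1) (by simp) (by cases j <;> simp),
    ShortComplex.moduleCat_exact_iff]
  rfl

theorem isZero_homologyAt_iff (X : Tame (CompactCh K)) (t : ℝ≥0) (j : ℕ) :
    IsZero ((homologyAt K t j).obj X) ↔ ((evalCh K t).obj X).ExactAt j :=
  (HomologicalComplex.exactAt_iff_isZero_homology _ _).symm

theorem val_sphere_d (n : ℕ) (I : Omega) (t : ℝ≥0) (i j : ℕ) (x : cell K (present n I t i)) :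
    Subtype.val (p := (· ∈ cell K (present n I t j)))
      (((intervalSphereComplex K n I t).d i j).hom x) =
      (if i = n + 1 ∧ j = n then (1 : K) else 0) * x.1 := rfl

theorem val_sphere_trans (n : ℕ) (I : Omega) {s t : ℝ≥0} (h : s ≤ t) (i : ℕ)
    (x : cell K (present n I s i)) :
    Subtype.val (p := (· ∈ cell K (present n I t i)))
      (((trans (intervalSphere K n I) h).f i).hom x) = x.1 := rfl

/-- The only values of `S^n[s,s)` are `0` and the disk. -/
theorem isZero_homologyAt_sphere_diag (n : ℕ) (s t : ℝ≥0) (j : ℕ) :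
    IsZero ((homologyAt K t j).obj (intervalSphere K n (Omega.diag s))) := by
  rw [isZero_homologyAt_iff]
  refine (exactAt_iff_forall (intervalSphereComplex K n (Omega.diag s) t) j).2
    fun (x : cell K (present n (Omega.diag s) t j)) hx => ?_
  have hx' := congrArg (Subtype.val (p := (· ∈ cell K (present n (Omega.diag s) t (j - 1))))) hx
  rw [val_sphere_d] at hx'
  change _ = (0 : K) at hx'
  rcases x.2 with (⟨rfl, h⟩ | ⟨rfl, h⟩) | h
  · refine ⟨(⟨x.1, Or.inl (Or.inr ⟨rfl, ENNReal.coe_le_coe.2 h⟩)⟩ :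
      cell K (present j (Omega.diag s) t (j + 1))), Subtype.ext ?_⟩
    rw [val_sphere_d]
    simp
  · refine ⟨0, ?_⟩
    rw [map_zero]
    have hx0 : (0 : K) = x.1 := by simpa using hx'.symm
    exact Subtype.ext hx0
  · refine ⟨0, ?_⟩
    rw [map_zero]
    exact Subtype.ext h.symm

/-- The degree `n` generator is a cycle already at `s`; to bound there it needs the degree `n + 1`
cell, so `e ≤ s`. -/
theorem eq_diag_of_isZero_homologyAt {n : ℕ} {I : Omega}
    (h : IsZero ((homologyAt K I.1.1 n).obj (intervalSphere K n I))) : I = Omega.diag I.1.1 := by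
  rw [isZero_homologyAt_iff] at h
  obtain ⟨y, hy⟩ := (exactAt_iff_forall (intervalSphereComplex K n I I.1.1) n).1 h
    (⟨1, Or.inl (Or.inl ⟨rfl, le_rfl⟩)⟩ : cell K (present n I I.1.1 n)) (Subtype.ext (by
      rw [val_sphere_d, if_neg (by omega), zero_mul]
      rfl))
  have hy' : (if n + 1 = n + 1 ∧ n = n then (1 : K) else 0) *
      Subtype.val (p := (· ∈ cell K (present n I I.1.1 (n + 1)))) y = 1 :=
    congrArg (Subtype.val (p := (· ∈ cell K (present n I I.1.1 n)))) hy
  have hp : present n I I.1.1 (n + 1) := by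
    by_contra hp
    have := (y : cell K (present n I I.1.1 (n + 1))).2.resolve_left hp
    rw [this] at hy'
    simp at hy'
  have he : I.1.2 ≤ (I.1.1 : ℝ≥0∞) := by
    rcases hp with hp | hp
    · omega
    · exact hp.2
  exact Subtype.ext (Prod.ext rfl (le_antisymm he I.2))

theorem not_isZero_sphere (n : ℕ) (I : Omega) : ¬ IsZero (intervalSphere K n I) := by
  intro h
  have h1 : IsZero ((intervalSphereComplex K n I I.1.1).X n) :=
    (HomologicalComplex.eval _ _ n).map_isZero ((evalCh K I.1.1).map_isZero h)
  have := ModuleCat.subsingleton_of_isZero h1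
  have h2 : (⟨1, Or.inl (Or.inl ⟨rfl, le_rfl⟩)⟩ : cell K (present n I I.1.1 n)) = 0 :=
    this.elim _ _
  exact one_ne_zero (congrArg Subtype.val h2)

/-! ### Complements and acyclic retracts -/

/-- Every retract has a complement. -/
theorem exists_complement {X S : Tame (CompactCh K)} (i : S ⟶ X) (r : X ⟶ S) (h : i ≫ r = 𝟙 S) :
    ∃ (Z : Tame (CompactCh K)) (i' : Z ⟶ X) (r' : X ⟶ Z), i' ≫ r' = 𝟙 Z ∧ i ≫ r' = 0 ∧
      i' ≫ r = 0 ∧ r ≫ i + r' ≫ i' = 𝟙 X := by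
  obtain ⟨Z, i', r', h1, h2⟩ := IsIdempotentComplete.idempotents_split X (𝟙 X - r ≫ i) (by
    simp [reassoc_of% h])
  have h3 : i ≫ r' ≫ i' = 0 := by simp [h2, reassoc_of% h]
  have h4 : (r' ≫ i') ≫ r = 0 := by simp [h2, h]
  refine ⟨Z, i', r', h1, ?_, ?_, by simp [h2]⟩
  · simpa [h1] using congrArg (· ≫ r') h3
  · simpa [reassoc_of% h1] using congrArg (i' ≫ ·) h4

/-- `Z` is the image of the Fitting idempotent of `φ`, where `φ ^ N` vanishes. On homology `φ ^ N`
is invertible, so the inclusion of `Z` induces zero; and if `φ ≫ c = c`, then `i ≫ c = i ≫ φ ^ N ≫ c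
= 0`. -/
theorem exists_acyclic_retract {X : Tame (CompactCh K)} (hX : HasMonoTransitions X) (φ : X ⟶ X)
    (hφ : WeakEquivalence φ) (h : ¬ IsIso φ) :
    ∃ (Z : Tame (CompactCh K)) (i : Z ⟶ X) (r : X ⟶ Z), i ≫ r = 𝟙 Z ∧ ¬ IsZero Z ∧
      (∀ t n, IsZero ((homologyAt K t n).obj Z)) ∧
      ∀ (Y : Tame (CompactCh K)) (c : X ⟶ Y), φ ≫ c = c → i ≫ c = 0 := by
  have := finite_end hX
  obtain ⟨e, he, ⟨N, hN⟩, hu⟩ :=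
    exists_fitting_idempotent (Algebra.IsIntegral.isIntegral (R := K) (A := End X) φ)
  obtain ⟨Z, i, r, hir, hri⟩ := IsIdempotentComplete.idempotents_split X e he
  let φ' : End X := φ
  let ψ : End X := φ' ^ N
  have hi : i ≫ ψ = 0 := by
    have h0 : e ≫ ψ = 0 := hN
    rw [← hri, Category.assoc] at h0
    rw [← Category.id_comp (i ≫ ψ), ← hir, Category.assoc, h0, comp_zero]
  rw [weakEquivalence_iff_homologyAt] at hφ
  refine ⟨Z, i, r, hir, fun hZ => h ?_, fun t n => ?_, fun Y c hc => ?_⟩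
  · rw [← isUnit_iff_isIso]
    refine hu ?_
    rw [← hri, hZ.eq_of_tgt r 0, zero_comp]
  · have hiso : ∀ N : ℕ, IsIso ((homologyAt K t n).map (φ' ^ N : End X)) := by
      intro N
      induction N with
      | zero =>
        rw [pow_zero, End.one_def, CategoryTheory.Functor.map_id]
        infer_instance
      | succ N ih =>
        have := hφ t n
        rw [pow_succ, End.mul_def, Functor.map_comp]
        infer_instance
    have := hiso N
    have h1 : (homologyAt K t n).map i = 0 := by
      rw [← cancel_mono ((homologyAt K t n).map ψ), ← Functor.map_comp, hi]
      simp
    rw [IsZero.iff_id_eq_zero, ← CategoryTheory.Functor.map_id, ← hir, Functor.map_comp, h1, zero_comp]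
  · have : ∀ N : ℕ, (φ' ^ N : End X) ≫ c = c := by
      intro N
      induction N with
      | zero => rw [pow_zero, End.one_def, Category.id_comp]
      | succ N ih => rw [pow_succ, End.mul_def, Category.assoc, ih, hc]
    rw [← this N, ← Category.assoc, hi, zero_comp]

/-! ### Morphisms from and to interval spheres -/

section SphereHoms

variable {X : Tame (CompactCh K)} {T : ℝ≥0} (hT : ∀ ⦃t⦄ (h : T ≤ t), IsIso (trans X h))

theorem toStable_injective (hX : HasMonoTransitions X) (t : ℝ≥0) (i : ℕ) :
    Function.Injective ((toStable X hT t).f i).hom := by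
  have := mono_toStable X hT hX t
  exact (ModuleCat.mono_iff_injective _).1 inferInstance

theorem toStable_trans_apply {s t : ℝ≥0} (h : s ≤ t) (i : ℕ) (x : ((evalCh K s).obj X).X i) :
    ((toStable X hT t).f i).hom (((trans X h).f i).hom x) = ((toStable X hT s).f i).hom x := by
  rw [← trans_toStable X hT h]
  rfl

theorem toStable_d_apply (t : ℝ≥0) (i j : ℕ) (x : ((evalCh K t).obj X).X i) :
    ((toStable X hT t).f j).hom ((((evalCh K t).obj X).d i j).hom x) =
      (((evalCh K T).obj X).d i j).hom (((toStable X hT t).f i).hom x) :=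
  (congrArg (fun f => f.hom x) ((toStable X hT t).comm i j)).symm

/-- Since `toStable` is injective, images of the two generators may be prescribed in the stable
value, provided they are already present at the parameters where the cells live. Naturality and the
chain map condition are checked there. -/
theorem exists_hom_from_sphere (hX : HasMonoTransitions X) (n : ℕ) (I : Omega)
    (w : ∀ i, ((evalCh K T).obj X).X i)
    (hw : ∀ t i, present n I t i → ∃ x, ((toStable X hT t).f i).hom x = w i)
    (hd : ∀ t i j, present n I t i →
      (((evalCh K T).obj X).d i j).hom (w i) = if i = n + 1 ∧ j = n then w j else 0) :
    ∃ g : intervalSphere K n I ⟶ X, ∀ t i (x : cell K (present n I t i)),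
      ((toStable X hT t).f i).hom ((((evalCh K t).map g).f i).hom x) = x.1 • w i := by
  have hv : ∀ t i, ∃ v, present n I t i → ((toStable X hT t).f i).hom v = w i := fun t i => by
    by_cases h : present n I t i
    · obtain ⟨v, hv⟩ := hw t i h
      exact ⟨v, fun _ => hv⟩
    · exact ⟨0, fun h' => absurd h' h⟩
  choose v hv using hv
  let G : ∀ t i, cell K (present n I t i) →ₗ[K] ((evalCh K t).obj X).X i := fun t i =>
    (LinearMap.toSpanSingleton K _ (v t i)).comp (cell K (present n I t i)).subtype
  have hG : ∀ t i (x : cell K (present n I t i)),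
      ((toStable X hT t).f i).hom (G t i x) = x.1 • w i := by
    intro t i x
    change ((toStable X hT t).f i).hom (x.1 • v t i) = _
    rw [map_smul]
    rcases x.2 with h | h
    · rw [hv t i h]
    · rw [h, zero_smul, zero_smul]
  let g : ∀ t, (evalCh K t).obj (intervalSphere K n I) ⟶ (evalCh K t).obj X := fun t =>
    { f := fun i => ModuleCat.ofHom (G t i)
      comm' := fun i j _ => by
        refine ModuleCat.hom_ext (LinearMap.ext fun (x : cell K (present n I t i)) => ?_)
        apply toStable_injective hT hX t j
        change ((toStable X hT t).f j).hom ((((evalCh K t).obj X).d i j).hom (G t i x)) =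
          ((toStable X hT t).f j).hom (G t j (((intervalSphereComplex K n I t).d i j).hom x))
        refine Eq.trans ?_ (hG t j _).symm
        rw [toStable_d_apply, hG, val_sphere_d, map_smul]
        rcases x.2 with h | h
        · rw [hd t i j h]
          split_ifs <;> simp
        · simp [h] }
  refine ⟨mkHom g fun s t h => ?_, hG⟩
  ext i : 1
  refine ModuleCat.hom_ext (LinearMap.ext fun (x : cell K (present n I s i)) => ?_)
  apply toStable_injective hT hX t i
  change ((toStable X hT t).f i).hom (G t i (((trans (intervalSphere K n I) h).f i).hom x)) =
    ((toStable X hT t).f i).hom (((trans X h).f i).hom (G s i x))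
  refine (hG t i _).trans ?_
  rw [toStable_trans_apply, hG, val_sphere_trans]

/-- The dual construction: functionals on the stable value that vanish on what exists before the
matching cell appears. -/
theorem exists_hom_to_sphere (n : ℕ) (I : Omega)
    (F : ∀ i, ((evalCh K T).obj X).X i →ₗ[K] K)
    (hF : ∀ t i x, present n I t i ∨ F i (((toStable X hT t).f i).hom x) = 0)
    (hd : ∀ i j x, F j ((((evalCh K T).obj X).d i j).hom x) =
      if i = n + 1 ∧ j = n then F i x else 0) :
    ∃ g : X ⟶ intervalSphere K n I, ∀ t i x,
      Subtype.val (p := (· ∈ cell K (present n I t i))) ((((evalCh K t).map g).f i).hom x) =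
        F i (((toStable X hT t).f i).hom x) := by
  let G : ∀ t i, ((evalCh K t).obj X).X i →ₗ[K] cell K (present n I t i) := fun t i =>
    ((F i).comp ((toStable X hT t).f i).hom).codRestrict _ (hF t i)
  have hG : ∀ t i x, (G t i x).1 = F i (((toStable X hT t).f i).hom x) := fun _ _ _ => rfl
  let g : ∀ t, (evalCh K t).obj X ⟶ (evalCh K t).obj (intervalSphere K n I) := fun t =>
    { f := fun i => ModuleCat.ofHom (G t i)
      comm' := fun i j _ => by
        refine ModuleCat.hom_ext (LinearMap.ext fun x => Subtype.ext ?_)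
        change Subtype.val (p := (· ∈ cell K (present n I t j)))
          (((intervalSphereComplex K n I t).d i j).hom (G t i x)) =
          (G t j ((((evalCh K t).obj X).d i j).hom x)).1
        rw [val_sphere_d, hG, hG, toStable_d_apply, hd]
        split_ifs <;> simp }
  refine ⟨mkHom g fun s t h => ?_, hG⟩
  ext i : 1
  refine ModuleCat.hom_ext (LinearMap.ext fun x => Subtype.ext ?_)
  change (G t i (((trans X h).f i).hom x)).1 = (G s i x).1
  rw [hG, hG, toStable_trans_apply]

end SphereHoms

/-! ### The filtration of the stable value -/

theorem exists_finset_isIso_trans (X : Tame (CompactCh K)) :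
    ∃ A : Finset ℝ≥0, ∀ t, ∃ a ∈ A, ∃ h : a ≤ t, IsIso (trans X h) := by
  obtain ⟨k, τ, hτ, hd⟩ := X.property
  classical
  -- Adding `0` ensures that every `t` has an element of `A` below it.
  let A : Finset ℝ≥0 := insert 0 (Finset.univ.image τ)
  refine ⟨A, fun t => ?_⟩
  have hne : (A.filter (· ≤ t)).Nonempty := ⟨0, by simp [A]⟩
  have hm := Finset.max'_mem _ hne
  rw [Finset.mem_filter] at hm
  refine ⟨_, hm.1, hm.2, hd.isIso_trans hm.2 ?_⟩
  rintro ⟨b, hb, hbt⟩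
  refine absurd (Finset.le_max' (A.filter (· ≤ t)) (τ b) ?_) (not_le.2 hb)
  simp [A, hbt]

/-- A condition on real parameters need not have a least solution; it does when every solution can
be moved down into a finite set, as tameness allows. -/
theorem exists_minimal_of_finset {A : Finset ℝ≥0} {P : ℝ≥0 → Prop}
    (h : ∀ t, P t → ∃ a ∈ A, a ≤ t ∧ P a) (hP : ∃ t, P t) :
    ∃ s, P s ∧ ∀ t, P t → s ≤ t := by
  classical
  have hne : (A.filter P).Nonempty := by
    obtain ⟨t, ht⟩ := hP
    obtain ⟨a, ha, -, hPa⟩ := h t ht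
    exact ⟨a, Finset.mem_filter.2 ⟨ha, hPa⟩⟩
  refine ⟨(A.filter P).min' hne, (Finset.mem_filter.1 (Finset.min'_mem _ hne)).2, fun t ht => ?_⟩
  obtain ⟨a, ha, hat, hPa⟩ := h t ht
  exact (Finset.min'_le _ _ (Finset.mem_filter.2 ⟨ha, hPa⟩)).trans hat

section Splitting

variable {X : Tame (CompactCh K)} {T : ℝ≥0} (hT : ∀ ⦃t⦄ (h : T ≤ t), IsIso (trans X h))

/-- The image at the stable value of the degree `i` part at the parameter `t`. -/
noncomputable def filt (i : ℕ) (t : ℝ≥0) : Submodule K (((evalCh K T).obj X).X i) :=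
  LinearMap.range ((toStable X hT t).f i).hom

theorem filt_mono (i : ℕ) : Monotone (filt hT i) := by
  rintro s t h _ ⟨x, rfl⟩
  exact ⟨((trans X h).f i).hom x, toStable_trans_apply hT h i x⟩

theorem filt_self (i : ℕ) : filt hT i T = ⊤ := by
  unfold filt
  rw [toStable_self]
  exact LinearMap.range_id

theorem d_mem_filt {i j : ℕ} {t : ℝ≥0} {x : ((evalCh K T).obj X).X i} (hx : x ∈ filt hT i t) :
    (((evalCh K T).obj X).d i j).hom x ∈ filt hT j t := by
  obtain ⟨y, rfl⟩ := hx
  exact ⟨_, toStable_d_apply hT t i j y⟩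

theorem exists_finset_filt (X : Tame (CompactCh K)) : ∃ A : Finset ℝ≥0, ∀ {T : ℝ≥0}
    (hT : ∀ ⦃t⦄ (h : T ≤ t), IsIso (trans X h)) (t : ℝ≥0),
    ∃ a ∈ A, a ≤ t ∧ ∀ i, filt hT i t ≤ filt hT i a := by
  obtain ⟨A, hA⟩ := exists_finset_isIso_trans X
  refine ⟨A, fun {T} hT t => ?_⟩
  obtain ⟨a, ha, hat, _⟩ := hA t
  refine ⟨a, ha, hat, fun i => ?_⟩
  rintro _ ⟨x, rfl⟩
  refine ⟨((inv (trans X hat)).f i).hom x, ?_⟩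
  have : inv (trans X hat) ≫ toStable X hT a = toStable X hT t := by
    rw [← trans_toStable X hT hat, IsIso.inv_hom_id_assoc]
  rw [← this]
  rfl

/-- The parts before `s` form a chain, so their supremum is their union (or zero if `s = 0`). It
misses `x`, and a functional separates the two. -/
theorem exists_functional (i : ℕ) (s : ℝ≥0) {x : ((evalCh K T).obj X).X i} (hx0 : x ≠ 0)
    (hx : ∀ t, x ∈ filt hT i t → s ≤ t) :
    ∃ f : ((evalCh K T).obj X).X i →ₗ[K] K, f x = 1 ∧
      ∀ t, t < s → ∀ z ∈ filt hT i t, f z = 0 := by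
  have hx' : x ∉ ⨆ t : Set.Iio s, filt hT i t := by
    rcases isEmpty_or_nonempty (Set.Iio s) with h | h
    · rwa [iSup_of_empty, Submodule.mem_bot]
    · rw [Submodule.mem_iSup_of_directed _
        (Monotone.directed_le fun (a b : Set.Iio s) hab => filt_mono hT i hab)]
      rintro ⟨t, ht⟩
      exact absurd (hx t ht) (not_le.2 t.2)
  obtain ⟨f, hf, hle⟩ := Submodule.exists_le_ker_of_notMem hx'
  refine ⟨(f x)⁻¹ • f, by simp [hf], fun t ht z hz => ?_⟩
  have : f z = 0 := hle (Submodule.mem_iSup_of_mem (⟨t, ht⟩ : Set.Iio s) hz)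
  simp [this]

end Splitting

/-! ### Maps between a complex and a disk -/

section Degrees

variable {C : Ch K} (n : ℕ)

open Classical in
/-- The elements `x` in degree `n` and `y` in degree `n + 1`, and zero elsewhere. -/
noncomputable def twoTerm (x : C.X n) (y : C.X (n + 1)) : ∀ i, C.X i :=
  Pi.single n x + Pi.single (n + 1) y

@[simp]
theorem twoTerm_self (x : C.X n) (y : C.X (n + 1)) : twoTerm n x y n = x := by
  simp [twoTerm]

@[simp]
theorem twoTerm_succ (x : C.X n) (y : C.X (n + 1)) : twoTerm n x y (n + 1) = y := by
  simp [twoTerm]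

open Classical in
/-- The functional `f` in degree `n`, its composite with the differential in degree `n + 1`, and
zero elsewhere. -/
noncomputable def twoTermFunctional (f : C.X n →ₗ[K] K) : ∀ i, C.X i →ₗ[K] K :=
  Pi.single n f + Pi.single (n + 1) (f.comp (C.d (n + 1) n).hom)

@[simp]
theorem twoTermFunctional_self (f : C.X n →ₗ[K] K) : twoTermFunctional n f n = f := by
  simp [twoTermFunctional]

@[simp]
theorem twoTermFunctional_succ (f : C.X n →ₗ[K] K) :
    twoTermFunctional n f (n + 1) = f.comp (C.d (n + 1) n).hom := by
  simp [twoTermFunctional]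

theorem twoTermFunctional_of_ne (f : C.X n →ₗ[K] K) {i : ℕ} (h : i ≠ n) (h' : i ≠ n + 1) :
    twoTermFunctional n f i = 0 := by
  simp [twoTermFunctional, h, h']

/-- Every functional on degree `n` extends to a chain map to `D^(n + 1)`; `d ∘ d = 0` handles degree
`n + 2`. -/
theorem twoTermFunctional_d (f : C.X n →ₗ[K] K) (i j : ℕ) (x : C.X i) :
    twoTermFunctional n f j ((C.d i j).hom x) =
      if i = n + 1 ∧ j = n then twoTermFunctional n f i x else 0 := by
  split_ifs with h
  · obtain ⟨rfl, rfl⟩ := h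
    simp
  · by_cases hij : i = j + 1
    · subst hij
      have h1 : j ≠ n := by rintro rfl; exact h ⟨rfl, rfl⟩
      by_cases h2 : j = n + 1
      · subst h2
        rw [twoTermFunctional_succ]
        have := congrArg (fun g => g.hom x) (C.d_comp_d (n + 1 + 1) (n + 1) n)
        change f ((C.d (n + 1) n).hom ((C.d (n + 1 + 1) (n + 1)).hom x)) = 0
        rw [show (C.d (n + 1) n).hom ((C.d (n + 1 + 1) (n + 1)).hom x) = 0 from this, map_zero]
      · rw [twoTermFunctional_of_ne n f h1 h2, LinearMap.zero_apply]
    · rw [C.shape i j (by simpa using fun h => hij h.symm)]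
      exact map_zero _

theorem d_twoTerm {x : C.X n} {y : C.X (n + 1)} (hx : ∀ j, (C.d n j).hom x = 0)
    (hy : (C.d (n + 1) n).hom y = x) (i j : ℕ) (hi : i = n ∨ i = n + 1) :
    (C.d i j).hom (twoTerm n x y i) = if i = n + 1 ∧ j = n then twoTerm n x y j else 0 := by
  rcases hi with rfl | rfl
  · rw [if_neg (by omega), twoTerm_self, hx]
  · rw [twoTerm_succ]
    split_ifs with h
    · obtain ⟨-, rfl⟩ := h
      rw [hy, twoTerm_self]
    · rw [C.shape (n + 1) j (by simp; omega)]
      rfl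

end Degrees

/-! ### Splitting off interval spheres -/

theorem isZero_of_stable {X : Tame (CompactCh K)} (hX : HasMonoTransitions X) {T : ℝ≥0}
    (hT : ∀ ⦃t⦄ (h : T ≤ t), IsIso (trans X h))
    (h : ∀ i, IsZero (((evalCh K T).obj X).X i)) : IsZero X := by
  rw [IsZero.iff_id_eq_zero]
  refine hom_ext_evalCh fun t => ?_
  have := mono_toStable X hT hX t
  rw [← cancel_mono (toStable X hT t)]
  ext i : 1
  exact (h i).eq_of_tgt _ _

/-- If some differential `d` from degree `n + 1` of the stable value is nonzero, let `e` be the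
first parameter at which it is nonzero on the filtration, then `s` the first at which a nonzero
boundary from level `e` appears, say `d y`. Choose `f` with `f (d y) = 1` that vanishes before `s`.
Minimality of `e` makes `f ∘ d` vanish before `e`, so `y` and `f` split off `S^n[s,e)`. If all
differentials vanish, the earliest nonzero element in a nonzero degree splits off `S^n[s,∞)`. -/
theorem exists_sphere_retract {X : Tame (CompactCh K)} (hX : HasMonoTransitions X)
    (h0 : ¬ IsZero X) :
    ∃ (n : ℕ) (I : Omega) (i : intervalSphere K n I ⟶ X) (r : X ⟶ intervalSphere K n I),
      i ≫ r = 𝟙 _ := by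
  obtain ⟨T, hT⟩ := exists_forall_isIso_trans X
  obtain ⟨A, hA⟩ := exists_finset_filt X
  let C := (evalCh K T).obj X
  -- Linear data for both maps: `w` gives the generators and `f` the retraction. Their composite is
  -- the identity because `f (w n) = 1`.
  suffices h : ∃ (n : ℕ) (I : Omega) (w : ∀ i, C.X i) (f : C.X n →ₗ[K] K),
      (∀ t i, present n I t i → w i ∈ filt hT i t) ∧
      (∀ t i j, present n I t i →
        (C.d i j).hom (w i) = if i = n + 1 ∧ j = n then w j else 0) ∧
      (∀ t, t < I.1.1 → ∀ z ∈ filt hT n t, f z = 0) ∧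
      (∀ t : ℝ≥0, (t : ℝ≥0∞) < I.1.2 → ∀ z ∈ filt hT (n + 1) t, f ((C.d (n + 1) n).hom z) = 0) ∧
      f (w n) = 1 by
    obtain ⟨n, I, w, f, h1, h2, h3, h4, h5⟩ := h
    obtain ⟨g, hg⟩ := exists_hom_from_sphere hT hX n I w h1 h2
    obtain ⟨r, hr⟩ := exists_hom_to_sphere hT n I (twoTermFunctional n f) (fun t i x => by
      by_cases hp : present n I t i
      · exact Or.inl hp
      · refine Or.inr ?_
        by_cases hn : i = n
        · subst hn
          rw [twoTermFunctional_self]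
          exact h3 t (by by_contra hs; exact hp (Or.inl ⟨rfl, not_lt.1 hs⟩)) _ ⟨x, rfl⟩
        · by_cases hn' : i = n + 1
          · subst hn'
            rw [twoTermFunctional_succ]
            exact h4 t (by by_contra hs; exact hp (Or.inr ⟨rfl, not_lt.1 hs⟩)) _ ⟨x, rfl⟩
          · rw [twoTermFunctional_of_ne n f hn hn', LinearMap.zero_apply])
      (twoTermFunctional_d n f)
    refine ⟨n, I, g, r, hom_ext_evalCh fun t => ?_⟩
    ext i : 1
    refine ModuleCat.hom_ext (LinearMap.ext fun (x : cell K (present n I t i)) =>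
      Subtype.ext ?_)
    rw [Functor.map_comp]
    change Subtype.val (p := (· ∈ cell K (present n I t i)))
      ((((evalCh K t).map r).f i).hom ((((evalCh K t).map g).f i).hom x)) = x.1
    rw [hr, hg, map_smul]
    rcases x.2 with hp | hp
    · have : twoTermFunctional n f i (w i) = 1 := by
        rcases id hp with ⟨rfl, -⟩ | ⟨rfl, -⟩
        · rw [twoTermFunctional_self, h5]
        · rw [twoTermFunctional_succ]
          change f ((C.d (n + 1) n).hom (w (n + 1))) = 1
          rw [h2 t (n + 1) n hp, if_pos ⟨rfl, rfl⟩, h5]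
      rw [this, smul_eq_mul, mul_one]
    · rw [hp, zero_smul]
  by_cases hd : ∃ n, (C.d (n + 1) n).hom ≠ 0
  · obtain ⟨n, hn⟩ := hd
    obtain ⟨e, ⟨y₀, hy₀, hdy₀⟩, he⟩ := exists_minimal_of_finset (A := A)
      (P := fun t => ∃ y ∈ filt hT (n + 1) t, (C.d (n + 1) n).hom y ≠ 0)
      (fun t ⟨y, hy, hy'⟩ => by
        obtain ⟨a, ha, hat, hle⟩ := hA hT t
        exact ⟨a, ha, hat, y, hle _ hy, hy'⟩)
      (by
        obtain ⟨y, hy⟩ := DFunLike.ne_iff.1 hn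
        exact ⟨T, y, by rw [filt_self]; trivial, hy⟩)
    obtain ⟨s, ⟨y, hy, hs, hdy⟩, hmin⟩ := exists_minimal_of_finset (A := A)
      (P := fun t => ∃ y ∈ filt hT (n + 1) e, (C.d (n + 1) n).hom y ∈ filt hT n t ∧
        (C.d (n + 1) n).hom y ≠ 0)
      (fun t ⟨y, hy, hy', hy''⟩ => by
        obtain ⟨a, ha, hat, hle⟩ := hA hT t
        exact ⟨a, ha, hat, y, hy, hle _ hy', hy''⟩)
      ⟨e, y₀, hy₀, d_mem_filt hT hy₀, hdy₀⟩
    have hse : s ≤ e := hmin e ⟨y₀, hy₀, d_mem_filt hT hy₀, hdy₀⟩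
    obtain ⟨f, hf, hf'⟩ := exists_functional hT n s hdy
      fun t ht => hmin t ⟨y, hy, ht, hdy⟩
    have hpi : ∀ {t i}, present n ⟨(s, (e : ℝ≥0∞)), ENNReal.coe_le_coe.2 hse⟩ t i →
        i = n ∨ i = n + 1 := fun hp => hp.imp And.left And.left
    refine ⟨n, ⟨(s, (e : ℝ≥0∞)), ENNReal.coe_le_coe.2 hse⟩,
      twoTerm n ((C.d (n + 1) n).hom y) y, f, ?_, fun t i j hp => d_twoTerm n (fun j => ?_) rfl i j
      (hpi hp), hf', fun t ht z hz => ?_, ?_⟩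
    · rintro t i (⟨rfl, h⟩ | ⟨rfl, h⟩)
      · rw [twoTerm_self]
        exact filt_mono hT i h hs
      · rw [twoTerm_succ]
        exact filt_mono hT _ (ENNReal.coe_le_coe.1 h) hy
    · exact congrArg (fun g => g.hom y) (C.d_comp_d (n + 1) n j)
    · have : (C.d (n + 1) n).hom z = 0 := by
        by_contra h
        exact absurd (he t ⟨z, hz, h⟩) (not_le.2 (ENNReal.coe_lt_coe.1 ht))
      rw [this, map_zero]
    · rw [twoTerm_self]
      exact hf
  · push Not at hd
    have hC : ∃ n, ¬ IsZero (C.X n) := by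
      by_contra! h
      exact h0 (isZero_of_stable hX hT h)
    obtain ⟨n, hn⟩ := hC
    have hd' : ∀ i j, (C.d i j).hom = 0 := fun i j => by
      by_cases hij : i = j + 1
      · rw [hij, hd]
      · rw [C.shape i j (by simpa using fun h => hij h.symm)]
        rfl
    obtain ⟨s, ⟨x, hs, hx⟩, hmin⟩ := exists_minimal_of_finset (A := A)
      (P := fun t => ∃ x ∈ filt hT n t, x ≠ 0)
      (fun t ⟨y, hy, hy'⟩ => by
        obtain ⟨a, ha, hat, hle⟩ := hA hT t
        exact ⟨a, ha, hat, y, hle _ hy, hy'⟩)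
      (by
        by_contra! h
        refine hn (@ModuleCat.isZero_of_subsingleton _ _ _ ⟨fun a b => ?_⟩)
        rw [h T a (by rw [filt_self]; trivial), h T b (by rw [filt_self]; trivial)])
    obtain ⟨f, hf, hf'⟩ := exists_functional hT n s hx fun t ht => hmin t ⟨x, ht, hx⟩
    refine ⟨n, ⟨(s, ⊤), le_top⟩, twoTerm n x 0, f, ?_, fun t i j hp => ?_, hf',
      fun t ht z hz => ?_, ?_⟩
    · rintro t i (⟨rfl, h⟩ | ⟨rfl, h⟩)
      · rw [twoTerm_self]
        exact filt_mono hT i h hs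
      · exact absurd h (by simp)
    · rcases hp with ⟨rfl, h⟩ | ⟨rfl, h⟩
      · rw [hd', if_neg (by omega), LinearMap.zero_apply]
      · exact absurd h (by simp)
    · rw [hd', LinearMap.zero_apply, map_zero]
    · rw [twoTerm_self]
      exact hf

/-- `End Z` embeds in `End X` by `f ↦ r' ≫ f ≫ i'`. The idempotent `r ≫ i` is not in the image,
since everything there vanishes between `i` and `r`. -/
theorem finrank_end_lt {X S Z : Tame (CompactCh K)} (hX : HasMonoTransitions X)
    {i : S ⟶ X} {r : X ⟶ S} {i' : Z ⟶ X} {r' : X ⟶ Z} (h : i ≫ r = 𝟙 S) (h' : i' ≫ r' = 𝟙 Z)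
    (h0 : i ≫ r' = 0) (hS : ¬ IsZero S) :
    Module.finrank K (End Z) < Module.finrank K (End X) := by
  have := finite_end hX
  let F : (Z ⟶ Z) →ₗ[K] (X ⟶ X) := (Linear.leftComp K X r').comp (Linear.rightComp K Z i')
  have hF : ∀ f, F f = r' ≫ f ≫ i' := fun _ => rfl
  have hinj : Function.Injective F := fun f g hfg => by
    rw [hF, hF] at hfg
    simpa [reassoc_of% h', h'] using congrArg (fun k => i' ≫ k ≫ r') hfg
  have hlt : LinearMap.range F < (⊤ : Submodule K (X ⟶ X)) := by
    rw [lt_top_iff_ne_top]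
    intro ht
    obtain ⟨f, hf⟩ : r ≫ i ∈ LinearMap.range F := ht ▸ Submodule.mem_top
    refine hS ((IsZero.iff_id_eq_zero S).2 ?_)
    have := congrArg (fun k => i ≫ k ≫ r) hf
    simpa [hF, reassoc_of% h0, reassoc_of% h, h] using this.symm
  have : Module.Finite K (X ⟶ X) := this
  calc Module.finrank K (Z ⟶ Z) = Module.finrank K (LinearMap.range F) :=
        (LinearMap.finrank_range_of_inj hinj).symm
    _ < Module.finrank K (X ⟶ X) := Submodule.finrank_lt hlt.ne

/-- A finite family of interval spheres, with inclusions and projections that exhibit `X` as their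
direct sum. -/
structure SphereDecomposition (X : Tame (CompactCh K)) (J : Type) [Fintype J] where
  label : J → ℕ × Omega
  ι : ∀ j, intervalSphere K (label j).1 (label j).2 ⟶ X
  π : ∀ j, X ⟶ intervalSphere K (label j).1 (label j).2
  ι_π_self : ∀ j, ι j ≫ π j = 𝟙 _
  ι_π_ne : ∀ ⦃j k⦄, j ≠ k → ι j ≫ π k = 0
  total : ∑ j, π j ≫ ι j = 𝟙 X

/-- Split off a sphere and pass to the complement; the dimension of the endomorphism ring drops. -/
theorem exists_sphereDecomposition {X : Tame (CompactCh K)} (hX : HasMonoTransitions X) :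
    ∃ (J : Type) (_ : Fintype J), Nonempty (SphereDecomposition X J) := by
  induction hm : Module.finrank K (End X) using Nat.strong_induction_on generalizing X with
  | _ m ih =>
  by_cases h0 : IsZero X
  · exact ⟨Empty, inferInstance, ⟨{
      label := Empty.elim
      ι := fun j => j.elim
      π := fun j => j.elim
      ι_π_self := fun j => j.elim
      ι_π_ne := fun j => j.elim
      total := h0.eq_of_src _ _ }⟩⟩
  obtain ⟨n, I, i, r, h⟩ := exists_sphere_retract hX h0
  obtain ⟨Z, i', r', h', h1, h2, h3⟩ := exists_complement i r h
  obtain ⟨J, _, ⟨D⟩⟩ := ih _ (hm ▸ finrank_end_lt hX h h' h1 (not_isZero_sphere n I))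
    (hX.of_retract i' r' h') rfl
  have hs : ∀ j k, (D.ι j ≫ i') ≫ r' ≫ D.π k = D.ι j ≫ D.π k := fun j k => by
    simp only [Category.assoc, reassoc_of% h']
  have ht : ∑ j, (r' ≫ D.π j) ≫ D.ι j ≫ i' = r' ≫ i' := by
    have := congrArg (fun f => r' ≫ f ≫ i') D.total
    simpa only [Preadditive.sum_comp, Preadditive.comp_sum, Category.id_comp, Category.assoc]
      using this
  exact ⟨Option J, inferInstance, ⟨{
    label := fun j => j.elim (n, I) D.label
    ι := fun j => match j with
      | none => i
      | some j => D.ι j ≫ i'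
    π := fun j => match j with
      | none => r
      | some j => r' ≫ D.π j
    ι_π_self := by
      rintro (_ | j)
      · exact h
      · exact (hs j j).trans (D.ι_π_self j)
    ι_π_ne := by
      rintro (_ | j) (_ | k) hjk
      · exact absurd rfl hjk
      · change i ≫ r' ≫ D.π k = 0
        rw [reassoc_of% h1, zero_comp]
      · change (D.ι j ≫ i') ≫ r = 0
        rw [Category.assoc, h2, comp_zero]
      · exact (hs j k).trans (D.ι_π_ne fun e => hjk (congrArg some e))
    total := by
      rw [Fintype.sum_option, ← h3, ← ht]
      rfl }⟩⟩

/-- The multiplicities of a decomposition. -/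
noncomputable def SphereDecomposition.multiplicity {X : Tame (CompactCh K)} {J : Type} [Fintype J]
    (D : SphereDecomposition X J) (n : ℕ) (I : Omega) : ℕ :=
  Nat.card {j // D.label j = (n, I)}

theorem SphereDecomposition.isBettiDiagrams {X : Tame (CompactCh K)} {J : Type} [Fintype J]
    (D : SphereDecomposition X J) : IsBettiDiagrams X D.multiplicity := by
  classical
  -- Summands are reindexed by their label and a number within its fibre; `eqToHom` transports along
  -- the resulting equality of labels.
  let e : (Σ p : ℕ × Omega, Fin (D.multiplicity p.1 p.2)) ≃ J :=
    (Equiv.sigmaCongrRight fun p => (Finite.equivFin {j // D.label j = p}).symm).trans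
      (Equiv.sigmaFiberEquiv D.label)
  have he : ∀ q, D.label (e q) = q.1 := fun q =>
    ((Finite.equivFin {j // D.label j = q.1}).symm q.2).2
  have : Finite (Σ p : ℕ × Omega, Fin (D.multiplicity p.1 p.2)) := Finite.of_equiv J e.symm
  have : Fintype (Σ p : ℕ × Omega, Fin (D.multiplicity p.1 p.2)) := Fintype.ofFinite _
  let S : ℕ × Omega → Tame (CompactCh K) := fun p => intervalSphere K p.1 p.2
  let ι : ∀ q : (Σ p : ℕ × Omega, Fin (D.multiplicity p.1 p.2)), S q.1 ⟶ X := fun q =>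
    eqToHom (congrArg S (he q).symm) ≫ D.ι (e q)
  let π : ∀ q : (Σ p : ℕ × Omega, Fin (D.multiplicity p.1 p.2)), X ⟶ S q.1 := fun q =>
    D.π (e q) ≫ eqToHom (congrArg S (he q))
  have h1 : ∀ q, ι q ≫ π q = 𝟙 _ := fun q => by
    simp only [ι, π, Category.assoc, reassoc_of% (D.ι_π_self (e q))]
    exact eqToHom_trans _ _
  have h2 : ∀ ⦃q q'⦄, q ≠ q' → ι q ≫ π q' = 0 := fun q q' h => by
    simp only [ι, π, Category.assoc, reassoc_of% (D.ι_π_ne (e.injective.ne h)), zero_comp,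
      comp_zero]
  have h3 : ∑ q, π q ≫ ι q = 𝟙 X := by
    rw [← D.total, ← e.sum_comp]
    refine Finset.sum_congr rfl fun q _ => ?_
    simp [ι, π]
  refine ⟨inferInstance, ι, ⟨Cofan.IsColimit.mk _ (fun s => ∑ q, π q ≫ s.inj q) (fun s q => ?_)
    (fun s m hm => ?_)⟩⟩
  · change ι q ≫ _ = _
    rw [Preadditive.comp_sum, Finset.sum_eq_single q]
    · rw [← Category.assoc, h1, Category.id_comp]
    · intro q' _ hq
      rw [← Category.assoc, h2 hq.symm, zero_comp]
    · simp
  · refine (Category.id_comp m).symm.trans ?_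
    change 𝟙 X ≫ m = _
    rw [← h3, Preadditive.sum_comp]
    refine Finset.sum_congr rfl fun q _ => ?_
    rw [Category.assoc]
    exact congrArg (π q ≫ ·) (hm q)

theorem isBettiDiagrams_betti {X : Tame (CompactCh K)} (hX : HasMonoTransitions X) :
    IsBettiDiagrams X (betti X) := by
  obtain ⟨J, _, ⟨D⟩⟩ := exists_sphereDecomposition hX
  have h : ∃ β, IsBettiDiagrams X β := ⟨_, D.isBettiDiagrams⟩
  rw [betti, dif_pos h]
  exact h.choose_spec

open Classical in
/-- The projections onto the summands of a coproduct. -/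
theorem exists_projections {C J : Type*} [Category C] [Preadditive C] {S : J → C} {X : C}
    {ι : ∀ j, S j ⟶ X} (h : IsColimit (Cofan.mk X ι)) :
    ∃ π : ∀ j, X ⟶ S j, (∀ j, ι j ≫ π j = 𝟙 _) ∧
      ∀ [Fintype J], ∑ j, π j ≫ ι j = 𝟙 X := by
  let π : ∀ j, X ⟶ S j := fun j => Cofan.IsColimit.desc h fun k =>
    if e : k = j then eqToHom (congrArg S e) else 0
  have hπ : ∀ k j, ι k ≫ π j = if e : k = j then eqToHom (congrArg S e) else 0 := fun k j =>
    Cofan.IsColimit.fac h _ k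
  refine ⟨π, fun j => by simp [hπ], ?_⟩
  intro _
  refine Cofan.IsColimit.hom_ext h _ _ fun k => ?_
  change ι k ≫ _ = ι k ≫ _
  rw [Preadditive.comp_sum, Finset.sum_eq_single k]
  · rw [← Category.assoc, hπ, dif_pos rfl]
    simp
  · intro j _ hj
    rw [← Category.assoc, hπ, dif_neg hj.symm, zero_comp]
  · simp

/-! ### Diagonal spheres as summands -/

/-- At `s` the element `x` bounds some `y`, so `g x` is a boundary in the target of `g`. This is
zero unless that sphere has dimension `n` and has died by `s`. In that case it was born strictly
before `s`, so `g x` comes from a parameter at which `S^n[s,s)` is still zero, and naturality of `r`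
kills it. -/
theorem sphere_comp_eq_zero {n m : ℕ} {s : ℝ≥0} {I : Omega} (hI : I ≠ Omega.diag I.1.1)
    (g : intervalSphere K n (Omega.diag s) ⟶ intervalSphere K m I)
    (r : intervalSphere K m I ⟶ intervalSphere K n (Omega.diag s))
    (x : cell K (present n (Omega.diag s) s n)) :
    (((evalCh K s).map (g ≫ r)).f n).hom x = 0 := by
  let G : ∀ i, cell K (present n (Omega.diag s) s i) → cell K (present m I s i) := fun i =>
    (((evalCh K s).map g).f i).hom
  rw [Functor.map_comp]
  change (((evalCh K s).map r).f n).hom (G n x) = 0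
  let y : cell K (present n (Omega.diag s) s (n + 1)) :=
    ⟨x.1, Or.inl (Or.inr ⟨rfl, le_rfl⟩)⟩
  have hy : ((intervalSphereComplex K n (Omega.diag s) s).d (n + 1) n).hom y = x :=
    Subtype.ext (by rw [val_sphere_d, if_pos ⟨rfl, rfl⟩, one_mul])
  have hx : (G n x).1 = (if n + 1 = m + 1 ∧ n = m then (1 : K) else 0) * (G (n + 1) y).1 := by
    have hc : ((intervalSphereComplex K m I s).d (n + 1) n).hom (G (n + 1) y) =
        G n (((intervalSphereComplex K n (Omega.diag s) s).d (n + 1) n).hom y) :=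
      congrArg (fun f => f.hom y) (((evalCh K s).map g).comm (n + 1) n)
    rw [hy] at hc
    rw [← hc]
    rfl
  by_cases h : n = m ∧ I.1.2 ≤ (s : ℝ≥0∞)
  · obtain ⟨rfl, he⟩ := h
    have hlt : I.1.1 < s := by
      refine ENNReal.coe_lt_coe.1 (lt_of_lt_of_le (lt_of_le_of_ne I.2 fun e => hI ?_) he)
      exact Subtype.ext (Prod.ext rfl e.symm)
    let z : cell K (present n I I.1.1 n) := ⟨(G n x).1, Or.inl (Or.inl ⟨rfl, le_rfl⟩)⟩
    have hz : ((trans (intervalSphere K n I) hlt.le).f n).hom z = G n x := rfl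
    rw [← hz]
    refine (congrArg (fun f => (f.f n).hom z) (trans_naturality r hlt.le)).trans ?_
    change ((trans _ hlt.le).f n).hom ((((evalCh K I.1.1).map r).f n).hom z) = 0
    have h0 : (((evalCh K I.1.1).map r).f n).hom z = 0 := by
      let v : cell K (present n (Omega.diag s) I.1.1 n) := (((evalCh K I.1.1).map r).f n).hom z
      refine Subtype.ext (v.2.resolve_left ?_)
      rintro (⟨-, h⟩ | ⟨h, -⟩)
      · exact absurd h (not_le.2 hlt)
      · omega
    rw [h0, map_zero]
  · have h0 : G n x = 0 := by
      refine Subtype.ext (hx.trans ?_)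
      change _ = (0 : K)
      by_cases hn : n = m
      · have hp : ¬ present m I s (n + 1) := by
          rintro (⟨h1, -⟩ | ⟨-, h2⟩)
          · omega
          · exact h ⟨hn, h2⟩
        rw [(G (n + 1) y).2.resolve_left hp, mul_zero]
      · rw [if_neg fun h' => hn h'.2, zero_mul]
    rw [h0]
    exact map_zero _

/-- Otherwise the identity of `S^n[s,s)` would be a sum of maps through non-diagonal spheres, each
of which kills the generator. -/
theorem not_retract_sphere_diag {X : Tame (CompactCh K)} {β : ℕ → Omega → ℕ}
    (hβ : IsBettiDiagrams X β) (h0 : ∀ n s, β n (Omega.diag s) = 0) {n : ℕ} {s : ℝ≥0}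
    (i : intervalSphere K n (Omega.diag s) ⟶ X) (r : X ⟶ intervalSphere K n (Omega.diag s)) :
    i ≫ r ≠ 𝟙 _ := by
  obtain ⟨_, ι, ⟨hι⟩⟩ := hβ
  have : Fintype (Σ p : ℕ × Omega, Fin (β p.1 p.2)) := Fintype.ofFinite _
  obtain ⟨π, -, hπ⟩ := exists_projections hι
  intro h
  let x : cell K (present n (Omega.diag s) s n) := ⟨1, Or.inl (Or.inl ⟨rfl, le_rfl⟩)⟩
  let F : (intervalSphere K n (Omega.diag s) ⟶ intervalSphere K n (Omega.diag s)) →+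
      ((intervalSphereComplex K n (Omega.diag s) s).X n) :=
    { toFun := fun g => (((evalCh K s).map g).f n).hom x
      map_zero' := rfl
      map_add' := fun _ _ => rfl }
  have h1 : F (𝟙 _) = x := rfl
  rw [← h, ← Category.id_comp r, ← hπ, Preadditive.sum_comp, Preadditive.comp_sum, map_sum,
    Finset.sum_eq_zero] at h1
  · exact zero_ne_one (congrArg Subtype.val h1)
  · intro q _
    have := sphere_comp_eq_zero (I := q.1.2) (fun e => ?_) (i ≫ π q) (ι q ≫ r) x
    · rw [Category.assoc] at this ⊢
      exact this
    · have := h0 q.1.1 q.1.2.1.1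
      rw [← e] at this
      exact (this ▸ q.2).elim0

theorem exists_sphere_diag_retract_of_acyclic {Z : Tame (CompactCh K)} (hZ : HasMonoTransitions Z) (h0 : ¬ IsZero Z)
    (hac : ∀ t n, IsZero ((homologyAt K t n).obj Z)) :
    ∃ (n : ℕ) (s : ℝ≥0) (i : intervalSphere K n (Omega.diag s) ⟶ Z)
      (r : Z ⟶ intervalSphere K n (Omega.diag s)), i ≫ r = 𝟙 _ := by
  obtain ⟨n, I, i, r, h⟩ := exists_sphere_retract hZ h0
  have hI : I = Omega.diag I.1.1 := by
    refine eq_diag_of_isZero_homologyAt (K := K) (n := n) ?_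
    rw [IsZero.iff_id_eq_zero, ← CategoryTheory.Functor.map_id, ← h, Functor.map_comp,
      (hac _ _).eq_of_tgt ((homologyAt K I.1.1 n).map i) 0, zero_comp]
  generalize I.1.1 = s at hI
  subst hI
  exact ⟨n, s, i, r, h⟩

/-- If a weak self equivalence `φ` of a cofibrant object is not an isomorphism, then the object has
a direct summand `S^n[s, s)` that is killed by every `φ`-invariant morphism. -/
theorem exists_sphere_diag_retract {X : Tame (CompactCh K)} (hX : IsCofibrant X) (φ : X ⟶ X)
    (hφ : WeakEquivalence φ) (h : ¬ IsIso φ) :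
    ∃ (n : ℕ) (s : ℝ≥0) (i : intervalSphere K n (Omega.diag s) ⟶ X)
      (r : X ⟶ intervalSphere K n (Omega.diag s)), i ≫ r = 𝟙 _ ∧
      ∀ (Y : Tame (CompactCh K)) (c : X ⟶ Y), φ ≫ c = c → i ≫ c = 0 := by
  have hX' := hasMonoTransitions_of_isCofibrant hX
  obtain ⟨Z, i, r, hir, hZ, hac, hc⟩ := exists_acyclic_retract hX' φ hφ h
  obtain ⟨n, s, j, q, hjq⟩ := exists_sphere_diag_retract_of_acyclic (hX'.of_retract i r hir) hZ hac
  refine ⟨n, s, j ≫ i, r ≫ q, by simp [reassoc_of% hir, hjq], fun Y c h => ?_⟩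
  rw [Category.assoc, hc Y c h, comp_zero]

/-! ### The two characterisations -/

theorem weakEquivalence_id_sub {X S : Tame (CompactCh K)}
    (hS : ∀ t n, IsZero ((homologyAt K t n).obj S)) (i : S ⟶ X) (r : X ⟶ S) :
    WeakEquivalence (𝟙 X - r ≫ i) := by
  rw [weakEquivalence_iff_homologyAt]
  intro t n
  rw [Functor.map_sub, Functor.map_comp, (hS t n).eq_of_tgt ((homologyAt K t n).map r) 0,
    zero_comp, sub_zero, CategoryTheory.Functor.map_id]
  infer_instance

theorem not_isIso_id_sub {X : Tame (CompactCh K)} {n : ℕ} {I : Omega}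
    {i : intervalSphere K n I ⟶ X} {r : X ⟶ intervalSphere K n I} (h : i ≫ r = 𝟙 _) :
    ¬ IsIso (𝟙 X - r ≫ i) := by
  intro _
  have h0 : i = 0 := by
    rw [← cancel_mono (𝟙 X - r ≫ i)]
    simp [reassoc_of% h]
  refine not_isZero_sphere (K := K) n I ((IsZero.iff_id_eq_zero _).2 ?_)
  rw [← h, h0, zero_comp]

theorem isMinimal_iff (X : Tame (CompactCh K)) :
    IsMinimal X ↔ IsCofibrant X ∧ ∀ (n : ℕ) (s : ℝ≥0), betti X n (Omega.diag s) = 0 := by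
  constructor
  · intro h
    refine ⟨h.isCofibrant, fun n s => ?_⟩
    by_contra hne
    obtain ⟨-, ι, ⟨hι⟩⟩ := isBettiDiagrams_betti (hasMonoTransitions_of_isCofibrant h.isCofibrant)
    obtain ⟨π, hπ, -⟩ := exists_projections hι
    let q : Σ p : ℕ × Omega, Fin (betti X p.1 p.2) :=
      ⟨(n, Omega.diag s), ⟨0, Nat.pos_of_ne_zero hne⟩⟩
    exact not_isIso_id_sub (hπ q) (h.isIso _ (weakEquivalence_id_sub
      (isZero_homologyAt_sphere_diag n s) (ι q) (π q)))
  · rintro ⟨hX, hβ⟩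
    refine ⟨hX, isFibrant X, fun φ hφ => ?_⟩
    by_contra h
    obtain ⟨n, s, i, r, hir, -⟩ := exists_sphere_diag_retract hX φ hφ h
    exact not_retract_sphere_diag
      (isBettiDiagrams_betti (hasMonoTransitions_of_isCofibrant hX)) hβ i r hir

theorem isMinimalCover_iff {X Y : Tame (CompactCh K)} (c : X ⟶ Y) :
    IsMinimalCover c ↔ IsCofibrant X ∧ WeakEquivalence c ∧ Fibration c ∧
      ∀ (n : ℕ) (s : ℝ≥0) (i : intervalSphere K n (Omega.diag s) ⟶ X),
        IsSplitMono i → i ≫ c ≠ 0 := by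
  constructor
  · intro h
    refine ⟨h.cofibration, h.weakEquivalence, h.fibration, fun n s i hi hc => ?_⟩
    obtain ⟨⟨r, hir⟩⟩ := hi
    refine not_isIso_id_sub hir (h.isIso _ (initialIsInitial.hom_ext _ _) ?_)
    simp [hc]
  · rintro ⟨hX, hw, hf, hs⟩
    refine ⟨hX, hf, hw, fun φ _ hφ => ?_⟩
    by_contra h
    -- Two out of three on homology, applied to `φ ≫ c = c`.
    have hφ' : WeakEquivalence φ := by
      rw [weakEquivalence_iff_homologyAt] at hw ⊢
      intro t n
      have := hw t n
      have h2 : IsIso ((homologyAt K t n).map φ ≫ (homologyAt K t n).map c) := by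
        rwa [← Functor.map_comp, hφ]
      exact IsIso.of_isIso_comp_right _ ((homologyAt K t n).map c)
    obtain ⟨n, s, i, r, hir, hc⟩ := exists_sphere_diag_retract hX φ hφ' h
    exact hs n s i ⟨⟨⟨r, hir⟩⟩⟩ (hc Y c hφ)

end TameCh

open TameCh
theorem mainTheorem5 (K : Type u) [Field K] :
    (∀ X : Tame (CompactCh K),
      IsMinimal X ↔
        IsCofibrant X ∧ ∀ (n : ℕ) (s : ℝ≥0), betti X n (Omega.diag s) = 0) ∧
    (∀ (X Y : Tame (CompactCh K)) (c : X ⟶ Y),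
      IsMinimalCover c ↔
        IsCofibrant X ∧ WeakEquivalence c ∧ Fibration c ∧
          ∀ (n : ℕ) (s : ℝ≥0) (i : intervalSphere K n (Omega.diag s) ⟶ X),
            IsSplitMono i → i ≫ c ≠ 0) :=
  ⟨isMinimal_iff, fun _ _ c => isMinimalCover_iff c⟩
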